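/- Let $n,m\ge 0$ be integers and identify $M_n(\mathbb R)\otimes M_m(\mathbb R)$ with the real $nm\times nm$ matrices via the Kronecker product. For $\mathbb K\in\{\mathbb R,\mathbb C\}$ let $$\operatorname{SEP}(\mathbb K^n\otimes\mathbb K^m)=\Big\{\sum_{i} A_i\otimes B_i\ \text{(finite sums)} : A_i\in M_n(\mathbb K),\ B_i\in M_m(\mathbb K)\ \text{positive semidefinite}\Big\}.$$ A positive semidefinite matrix $P\in M_n(\mathbb R)\otimes M_m(\mathbb R)$ is called $\mathbb R$-entangled if $P\notin\operatorname{SEP}(\mathbb R^n\otimes\mathbb R^m)$, and $\mathbb C$-separable if $P$, regarded as a complex matrix, belongs to $\operatorname{SEP}(\mathbb C^n\otimes\mathbb C^m)$. Let $T$ denote the transpose on $M_m(\mathbb R)$. **Proposition.** For every symmetric matrix $A\in M_n(\mathbb R)\otimes M_m(\mathbb R)$ with $(\mathrm{id}\otimes T)(A)\ne A$ there exists $s_*>0$ such that for every $s\in(0,s_*]$ the matrix $$P_s=(1-s)\,I_n\otimes I_m+s\,A$$ is positive semidefinite, $\mathbb R$-entangled and $\mathbb C$-separable. -/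

import Mathlib

open scoped ComplexOrder Kronecker

namespace RealEntanglement

/-- The cone `SEP(𝕜ⁿ ⊗ 𝕜ᵐ)` of finite sums `∑ᵢ Aᵢ ⊗ Bᵢ` with `Aᵢ` and `Bᵢ` positive semidefinite
over `𝕜`. Here `Mₙ(𝕜) ⊗ Mₘ(𝕜)` is the algebra of matrices indexed by `Fin n × Fin m`, elementary
tensors being Kronecker products. -/
def SEP (𝕜 : Type*) [RCLike 𝕜] (n m : ℕ) : Set (Matrix (Fin n × Fin m) (Fin n × Fin m) 𝕜) :=
  {P | ∃ (k : ℕ) (A : Fin k → Matrix (Fin n) (Fin n) 𝕜) (B : Fin k → Matrix (Fin m) (Fin m) 𝕜),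
    (∀ i, (A i).PosSemidef) ∧ (∀ i, (B i).PosSemidef) ∧ P = ∑ i, A i ⊗ₖ B i}

/-- `P` is `𝕜`-entangled: it is positive semidefinite but not `𝕜`-separable. -/
def IsEntangled {𝕜 : Type*} [RCLike 𝕜] {n m : ℕ}
    (P : Matrix (Fin n × Fin m) (Fin n × Fin m) 𝕜) : Prop :=
  P.PosSemidef ∧ P ∉ SEP 𝕜 n m

/-- The cone `CSEP(ℝⁿ ⊗ ℝᵐ) = SEP(ℂⁿ ⊗ ℂᵐ) ∩ PSD(ℝⁿ ⊗ ℝᵐ)` of real positive semidefinite matrices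
that are `ℂ`-separable. -/
def CSEP (n m : ℕ) : Set (Matrix (Fin n × Fin m) (Fin n × Fin m) ℝ) :=
  {P | P.PosSemidef ∧ P.map ((↑) : ℝ → ℂ) ∈ SEP ℂ n m}

/-- The partial transpose `id ⊗ T` on the second tensor factor, as a linear map. -/
def partialTranspose {n m : ℕ} :
    Matrix (Fin n × Fin m) (Fin n × Fin m) ℝ →ₗ[ℝ] Matrix (Fin n × Fin m) (Fin n × Fin m) ℝ where
  toFun P := Matrix.of fun i j => P (i.1, j.2) (j.1, i.2)
  map_add' _ _ := rfl
  map_smul' _ _ := rfl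

/-- `id ⊗ T` acts on elementary tensors as it should. -/
theorem partialTranspose_kronecker {n m : ℕ} (A : Matrix (Fin n) (Fin n) ℝ)
    (B : Matrix (Fin m) (Fin m) ℝ) :
    partialTranspose (A ⊗ₖ B) = A ⊗ₖ B.transpose := rfl

end RealEntanglement

namespace RealEntanglement

open Matrix

section Cone

variable {𝕜 : Type*} [RCLike 𝕜] {n m : ℕ}

/-! Real positive semidefinite matrices are symmetric, so `id ⊗ T` fixes `SEP ℝ n m` pointwise; it
fixes `1` and moves `A`, hence moves `P_s` for `s ≠ 0`, which forces entanglement. Over `ℂ`, every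
Hermitian matrix is a sum of `X ⊗ₖ Y` with Hermitian factors, and each such term becomes separable
after adding a multiple of `1`. So `c • 1 + A` is `ℂ`-separable for some `c ≥ 0`, and so is `P_s =
(1 - s - s * c) • 1 + s • (c • 1 + A)` for small `s`; this also gives positivity. -/

theorem zero_mem_SEP : (0 : Matrix (Fin n × Fin m) (Fin n × Fin m) 𝕜) ∈ SEP 𝕜 n m :=
  ⟨0, fun _ => 0, fun _ => 0, fun i => i.elim0, fun i => i.elim0, by simp⟩

theorem kronecker_mem_SEP {A : Matrix (Fin n) (Fin n) 𝕜} {B : Matrix (Fin m) (Fin m) 𝕜}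
    (hA : A.PosSemidef) (hB : B.PosSemidef) : A ⊗ₖ B ∈ SEP 𝕜 n m :=
  ⟨1, fun _ => A, fun _ => B, fun _ => hA, fun _ => hB, by simp⟩

theorem add_mem_SEP {P Q : Matrix (Fin n × Fin m) (Fin n × Fin m) 𝕜}
    (hP : P ∈ SEP 𝕜 n m) (hQ : Q ∈ SEP 𝕜 n m) : P + Q ∈ SEP 𝕜 n m := by
  obtain ⟨k, A, B, hA, hB, rfl⟩ := hP
  obtain ⟨l, C, D, hC, hD, rfl⟩ := hQ
  refine ⟨k + l, Fin.append A C, Fin.append B D, fun i => ?_, fun i => ?_, ?_⟩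
  · refine Fin.addCases (fun j => ?_) (fun j => ?_) i
    · simpa using hA j
    · simpa using hC j
  · refine Fin.addCases (fun j => ?_) (fun j => ?_) i
    · simpa using hB j
    · simpa using hD j
  · simp [Fin.sum_univ_add]

theorem smul_mem_SEP {P : Matrix (Fin n × Fin m) (Fin n × Fin m) 𝕜} {c : ℝ} (hc : 0 ≤ c)
    (hP : P ∈ SEP 𝕜 n m) : (c : 𝕜) • P ∈ SEP 𝕜 n m := by
  obtain ⟨k, A, B, hA, hB, rfl⟩ := hP
  refine ⟨k, fun i => (c : 𝕜) • A i, B, fun i => ?_, hB, ?_⟩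
  · exact (hA i).smul (RCLike.ofReal_nonneg.2 hc)
  · simp [Finset.smul_sum, smul_kronecker]

theorem one_mem_SEP : (1 : Matrix (Fin n × Fin m) (Fin n × Fin m) 𝕜) ∈ SEP 𝕜 n m := by
  rw [← one_kronecker_one]
  exact kronecker_mem_SEP PosSemidef.one PosSemidef.one

theorem posSemidef_of_mem_SEP {P : Matrix (Fin n × Fin m) (Fin n × Fin m) 𝕜}
    (hP : P ∈ SEP 𝕜 n m) : P.PosSemidef := by
  obtain ⟨k, A, B, hA, hB, rfl⟩ := hP
  exact posSemidef_sum _ fun i _ => (hA i).kronecker (hB i)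

end Cone

theorem partialTranspose_eq_self_of_mem_SEP {n m : ℕ}
    {P : Matrix (Fin n × Fin m) (Fin n × Fin m) ℝ} (hP : P ∈ SEP ℝ n m) :
    partialTranspose P = P := by
  obtain ⟨k, A, B, -, hB, rfl⟩ := hP
  rw [map_sum]
  refine Finset.sum_congr rfl fun i _ => ?_
  rw [partialTranspose_kronecker, ← conjTranspose_eq_transpose_of_trivial, (hB i).isHermitian.eq]

section Shift

variable {n m : ℕ}

open scoped MatrixOrder Matrix.Norms.L2Operator in
theorem exists_posSemidef_smul_one_add_sub {n : ℕ} {X : Matrix (Fin n) (Fin n) ℂ}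
    (hX : X.IsHermitian) :
    ∃ a : ℝ, 0 ≤ a ∧ ((a : ℂ) • 1 + X).PosSemidef ∧ ((a : ℂ) • 1 - X).PosSemidef := by
  have hs : IsSelfAdjoint X := hX
  refine ⟨‖X‖, norm_nonneg X, ?_, ?_⟩
  · have h := hs.neg_algebraMap_norm_le_self
    rw [Matrix.le_iff, sub_neg_eq_add, add_comm, Algebra.algebraMap_eq_smul_one] at h
    simpa using h
  · have h := hs.le_algebraMap_norm_self
    rw [Matrix.le_iff, Algebra.algebraMap_eq_smul_one] at h
    simpa using h

/-- The matrices that become `ℂ`-separable after adding a nonnegative multiple of the identity. -/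
def ShiftSeparable (H : Matrix (Fin n × Fin m) (Fin n × Fin m) ℂ) : Prop :=
  ∃ c : ℝ, 0 ≤ c ∧ (c : ℂ) • 1 + H ∈ SEP ℂ n m

namespace ShiftSeparable

theorem zero : ShiftSeparable (0 : Matrix (Fin n × Fin m) (Fin n × Fin m) ℂ) :=
  ⟨0, le_rfl, by simpa using zero_mem_SEP⟩

theorem add {H K : Matrix (Fin n × Fin m) (Fin n × Fin m) ℂ} (hH : ShiftSeparable H)
    (hK : ShiftSeparable K) : ShiftSeparable (H + K) := by
  obtain ⟨c, hc, hcH⟩ := hH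
  obtain ⟨d, hd, hdK⟩ := hK
  refine ⟨c + d, add_nonneg hc hd, ?_⟩
  convert add_mem_SEP hcH hdK using 1
  push_cast
  module

/-- The cross terms cancel in the average of `(a + X) ⊗ (b + Y)` and `(a - X) ⊗ (b - Y)`, leaving
`ab + X ⊗ Y`. -/
theorem kronecker {X : Matrix (Fin n) (Fin n) ℂ} {Y : Matrix (Fin m) (Fin m) ℂ}
    (hX : X.IsHermitian) (hY : Y.IsHermitian) : ShiftSeparable (X ⊗ₖ Y) := by
  obtain ⟨a, ha, ha₁, ha₂⟩ := exists_posSemidef_smul_one_add_sub hX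
  obtain ⟨b, hb, hb₁, hb₂⟩ := exists_posSemidef_smul_one_add_sub hY
  refine ⟨a * b, mul_nonneg ha hb, ?_⟩
  convert smul_mem_SEP (c := 1 / 2) (by norm_num)
    (add_mem_SEP (kronecker_mem_SEP ha₁ hb₁) (kronecker_mem_SEP ha₂ hb₂)) using 1
  rw [← one_kronecker_one]
  ext ⟨i, j⟩ ⟨k, l⟩
  simp only [Matrix.add_apply, Matrix.sub_apply, Matrix.smul_apply, kroneckerMap_apply, smul_eq_mul]
  push_cast
  ring

/-- With `X = X₁ + iX₂`, `Y = Y₁ + iY₂` and Hermitian parts, the sum is `2 (X₁ ⊗ Y₁ - X₂ ⊗ Y₂)`.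
Complex scalars are essential: real `X`, `Y` can have nonzero `X₂`, `Y₂`. -/
theorem symmetrized_kronecker (X : Matrix (Fin n) (Fin n) ℂ) (Y : Matrix (Fin m) (Fin m) ℂ) :
    ShiftSeparable (X ⊗ₖ Y + Xᴴ ⊗ₖ Yᴴ) := by
  have h₁ : (X + Xᴴ).IsHermitian := isHermitian_add_transpose_self X
  have h₂ : ((1 / 2 : ℂ) • (Y + Yᴴ)).IsHermitian := by
    simp [IsHermitian, conjTranspose_smul, add_comm]
  have h₃ : (Complex.I • (X - Xᴴ)).IsHermitian := by
    simp [IsHermitian, conjTranspose_smul, smul_sub]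
    abel
  have h₄ : ((Complex.I / 2) • (Y - Yᴴ)).IsHermitian := by
    simp [IsHermitian, conjTranspose_smul, smul_sub, neg_div]
    abel
  have h₅ : (-((Complex.I / 2) • (Y - Yᴴ))).IsHermitian := h₄.neg
  convert (kronecker h₁ h₂).add (kronecker h₃ h₅) using 1
  ext ⟨i, j⟩ ⟨k, l⟩
  simp only [Matrix.add_apply, Matrix.sub_apply, Matrix.neg_apply, Matrix.smul_apply,
    kroneckerMap_apply, smul_eq_mul]
  linear_combination ((X i k - Xᴴ i k) * (Y j l - Yᴴ j l) / 2) * Complex.I_sq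

theorem of_isHermitian {H : Matrix (Fin n × Fin m) (Fin n × Fin m) ℂ} (hH : H.IsHermitian) :
    ShiftSeparable H := by
  -- Expand `H = H/2 + (H/2)ᴴ` in matrix units, each of which is an elementary tensor.
  have key : H = ∑ p, ∑ q, (single p.1 q.1 (H p q / 2) ⊗ₖ single p.2 q.2 (1 : ℂ) +
      (single p.1 q.1 (H p q / 2))ᴴ ⊗ₖ (single p.2 q.2 (1 : ℂ))ᴴ) := by
    have hsum : ∑ p, ∑ q, single p.1 q.1 (H p q / 2) ⊗ₖ single p.2 q.2 (1 : ℂ) =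
        (1 / 2 : ℂ) • H := by
      conv_rhs => rw [matrix_eq_sum_single H]
      simp only [Finset.smul_sum]
      refine Finset.sum_congr rfl fun p _ => Finset.sum_congr rfl fun q _ => ?_
      rw [single_kronecker_single, smul_single]
      simp [div_eq_inv_mul]
    simp only [← conjTranspose_kronecker, Finset.sum_add_distrib, ← conjTranspose_sum, hsum]
    rw [conjTranspose_smul, hH.eq]
    simp only [one_div, star_inv₀, star_ofNat]
    module
  rw [key]
  exact Finset.sum_induction _ ShiftSeparable (fun _ _ => add) zero fun p _ =>
    Finset.sum_induction _ ShiftSeparable (fun _ _ => add) zero fun q _ =>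
      symmetrized_kronecker _ _

end ShiftSeparable

end Shift

theorem posSemidef_of_posSemidef_map_ofReal {ι : Type*} [Fintype ι] {P : Matrix ι ι ℝ}
    (hP : (P.map ((↑) : ℝ → ℂ)).PosSemidef) : P.PosSemidef := by
  refine PosSemidef.of_dotProduct_mulVec_nonneg ?_ fun x => ?_
  · ext i j
    have h := hP.isHermitian.apply i j
    simpa using h
  · have h := hP.dotProduct_mulVec_nonneg (fun i => (x i : ℂ))
    rw [← Complex.zero_le_real]
    convert h using 1
    simp [dotProduct, mulVec]

end RealEntanglement

open RealEntanglement in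
theorem mainTheorem12 (n m : ℕ) (A : Matrix (Fin n × Fin m) (Fin n × Fin m) ℝ)
    (hsymm : A.IsSymm) (hA : RealEntanglement.partialTranspose A ≠ A) :
    ∃ s₀ : ℝ, 0 < s₀ ∧ ∀ s ∈ Set.Ioc (0 : ℝ) s₀,
      RealEntanglement.IsEntangled
        ((1 - s) • ((1 : Matrix (Fin n) (Fin n) ℝ) ⊗ₖ (1 : Matrix (Fin m) (Fin m) ℝ)) + s • A) ∧
      (1 - s) • ((1 : Matrix (Fin n) (Fin n) ℝ) ⊗ₖ (1 : Matrix (Fin m) (Fin m) ℝ)) + s • A ∈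
        RealEntanglement.CSEP n m := by
  have hherm : (A.map ((↑) : ℝ → ℂ)).IsHermitian := by
    ext i j
    simp [hsymm.apply i j]
  obtain ⟨c, hc, hcA⟩ := ShiftSeparable.of_isHermitian hherm
  -- `s ≤ 1 / (1 + c)` says exactly that the coefficient `1 - s - s * c` of the identity is
  -- nonnegative.
  refine ⟨1 / (1 + c), by positivity, fun s hs => ?_⟩
  obtain ⟨hs₀, hs₁⟩ := hs
  have hs₂ : 0 ≤ 1 - s - s * c := by
    rw [le_div_iff₀ (by positivity)] at hs₁
    linarith
  have hsep : ((1 - s) • ((1 : Matrix (Fin n) (Fin n) ℝ) ⊗ₖ (1 : Matrix (Fin m) (Fin m) ℝ)) +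
      s • A).map ((↑) : ℝ → ℂ) ∈ SEP ℂ n m := by
    convert add_mem_SEP (smul_mem_SEP hs₂ one_mem_SEP) (smul_mem_SEP hs₀.le hcA) using 1
    rw [Matrix.one_kronecker_one]
    ext p q
    by_cases hpq : p = q
    · subst hpq
      simp
      ring
    · simp [hpq]
  have hpsd := posSemidef_of_posSemidef_map_ofReal (posSemidef_of_mem_SEP hsep)
  refine ⟨⟨hpsd, fun hmem => hA ?_⟩, hpsd, hsep⟩
  have h := partialTranspose_eq_self_of_mem_SEP hmem
  rw [map_add, map_smul, map_smul, partialTranspose_kronecker, Matrix.transpose_one] at h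
  exact smul_right_injective _ hs₀.ne' (add_left_cancel h)
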